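/- Let $q:\mathbb{R}\to[0,\infty)$ be a probability density on $\mathbb{R}$ with mean zero. For $d\ge 1$ and $\mu_d\in\mathbb{R}$, let $Y$ be uniform on $\{\pm1\}$, let $z_1,\dots,z_d$ be i.i.d. with density $q$ and independent of $Y$, and let $x^{(d)}_i=Y\mu_d+z_i$ for $1\le i\le d$. For a measurable classifier $\mathcal C:\mathbb{R}^d\to\{\pm1\}$ and an integer $k\ge 0$, the robust error of $\mathcal C$ is $\mathbb{E}\big[\max_{x'}\mathbf 1\{\mathcal C(x')\ne Y\}\big]$, the maximum being over all $x'\in\mathbb{R}^d$ that differ from $x^{(d)}$ in at most $k$ coordinates. Let $\mathcal L^{*(d)}_{\mu_d,q}$ be the infimum of the robust error over all measurable classifiers for $k=0$, that is, the optimal Bayes error $\inf_{\mathcal C}\mathbb{P}(\mathcal C(x^{(d)})\neq Y)$ in the absence of an adversary. Assume: 1. $q(z)>0$ for all $z\in\mathbb{R}$; $q$ is three times continuously differentiable; $q'$ and $q''$ are integrable with $\int_{-\infty}^\infty q'(z)\,dz=\int_{-\infty}^\infty q''(z)\,dz=0$; and for every $\theta\in\mathbb{R}$ the Fisher information $\mathcal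 I_q(\theta)=\int_{-\infty}^{\infty}\big(\tfrac{\partial}{\partial\theta}\log q(z-\theta)\big)^2q(z-\theta)\,dz$ of the location family $q(z-\theta)$ is finite. 2. There exists $\zeta>0$ such that $\mathbb{E}_{Z\sim q}\Big[\sup_{t\in[Z-\zeta,Z+\zeta]}\big|\tfrac{d^3}{dt^3}\log q(t)\big|\Big]<\infty$. Let $\mu_d=c/\sqrt d$ for a constant $c>0$, and let $\mathcal I_q=\int_{-\infty}^\infty \frac{q'(z)^2}{q(z)}\,dz$. Then: (a) $\mathcal I_q(\theta)=\mathcal I_q$ for all $\theta\in\mathbb{R}$. (b) $\lim_{d\to\infty}\mathcal L^{*(d)}_{\mu_d,q}=\bar\Phi\big(c\sqrt{\mathcal I_q}\big)$, where $\bar\Phi(x)=\frac1{\sqrt{2\pi}}\int_x^\infty e^{-t^2/2}\,dt$. (c) As $d\to\infty$, the log-likelihood ratio $\sum_{i=1}^d\log\frac{q(x^{(d)}_i-\mu_d)}{q(x^{(d)}_i+\mu_d)}$ converges in distribution to $\mathcal N(2c^2\mathcal I_q,\,4c^2\mathcal I_q)$ conditioned on $Y=+1$, and to $\mathcal N(-2c^2\mathcal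 I_q,\,4c^2\mathcal I_q)$ conditioned on $Y=-1$, where $\mathcal N(m,s)$ is the normal distribution with mean $m$ and variance $s$. -/

import Mathlib

open MeasureTheory ProbabilityTheory Filter Topology

noncomputable section

namespace L0Classification

/-- The complementary CDF of the standard normal distribution. -/
def PhiBar (x : ℝ) : ℝ :=
  (√(2 * Real.pi))⁻¹ * ∫ t in Set.Ioi x, Real.exp (-t ^ 2 / 2)

/-- The distribution on the real line with density `q`. -/
def noise (q : ℝ → ℝ) : Measure ℝ :=
  volume.withDensity fun z => ENNReal.ofReal (q z)

/-- The uniform distribution on the set of labels. The labels `1` and `-1` are the two units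
of the integers. -/
def labelLaw : Measure ℤˣ := (PMF.uniformOfFintype ℤˣ).toMeasure

/-- The joint distribution of the label `y` and of the data `x i = y * μ + z i`, where `y` is
uniform on `{1, -1}` and the `z i` are i.i.d. with density `q`, independent of `y`. -/
def dataLaw (q : ℝ → ℝ) (μ : ℝ) (d : ℕ) : Measure (ℤˣ × (Fin d → ℝ)) :=
  (labelLaw.prod (Measure.pi fun _ : Fin d => noise q)).map
    fun p => (p.1, fun i => ((p.1 : ℤ) : ℝ) * μ + p.2 i)

/-- The joint distribution of label and data, conditioned on the event that the label is `y`. -/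
def condDataLaw (q : ℝ → ℝ) (μ : ℝ) (d : ℕ) (y : ℤˣ) : Measure (ℤˣ × (Fin d → ℝ)) :=
  ProbabilityTheory.cond (dataLaw q μ d) {p | p.1 = y}

/-- The number of nonzero coordinates. -/
def l0Norm {d : ℕ} (x : Fin d → ℝ) : ℕ := Set.ncard {i | x i ≠ 0}

/-- The set of the perturbations of `x` in at most `k` coordinates. -/
def l0Ball {d : ℕ} (x : Fin d → ℝ) (k : ℕ) : Set (Fin d → ℝ) := {x' | l0Norm (x - x') ≤ k}

/-- The 0-1 loss. -/
def loss {d : ℕ} (C : (Fin d → ℝ) → ℤˣ) (x : Fin d → ℝ) (y : ℤˣ) : ℝ :=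
  if C x ≠ y then 1 else 0

/-- The robust error of the classifier `C` against an adversary with budget `k`. -/
def robustError (q : ℝ → ℝ) (μ : ℝ) (d : ℕ) (C : (Fin d → ℝ) → ℤˣ) (k : ℕ) : ℝ :=
  ∫ p, (⨆ x' : l0Ball p.2 k, loss C x' p.1) ∂(dataLaw q μ d)

/-- The optimal robust error: the infimum over all measurable classifiers. -/
def optimalRobustError (q : ℝ → ℝ) (μ : ℝ) (d : ℕ) (k : ℕ) : ℝ :=
  ⨅ C : {C : (Fin d → ℝ) → ℤˣ // Measurable C}, robustError q μ d C k

/-- The optimal Bayes error, that is, the optimal error in the absence of an adversary. -/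
def optimalBayesError (q : ℝ → ℝ) (μ : ℝ) (d : ℕ) : ℝ := optimalRobustError q μ d 0

/-- The log-likelihood ratio of the data `x`. -/
def logLikelihood (q : ℝ → ℝ) (μ : ℝ) {d : ℕ} (x : Fin d → ℝ) : ℝ :=
  ∑ i, Real.log (q (x i - μ) / q (x i + μ))

/-- The integrand in the Fisher information of the location family `q (z - θ)`. -/
def fisherIntegrand (q : ℝ → ℝ) (θ z : ℝ) : ℝ :=
  (deriv (fun s => Real.log (q (z - s))) θ) ^ 2 * q (z - θ)

/-- The Fisher information at `θ` of the location family `q (z - θ)`. -/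
def fisherInfoAt (q : ℝ → ℝ) (θ : ℝ) : ℝ := ∫ z, fisherIntegrand q θ z

/-- The common value of the Fisher information of the location family `q (z - θ)`. -/
def fisherInfo (q : ℝ → ℝ) : ℝ := ∫ z, (deriv q z) ^ 2 / q z

/-- The regularity assumption on the noise density. -/
structure FisherRegular (q : ℝ → ℝ) : Prop where
  pos : ∀ z, 0 < q z
  contDiff : ContDiff ℝ 3 q
  integrable_deriv : Integrable (deriv q)
  integral_deriv : ∫ z, deriv q z = 0
  integrable_deriv2 : Integrable (iteratedDeriv 2 q)
  integral_deriv2 : ∫ z, iteratedDeriv 2 q z = 0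
  integrable_fisher : ∀ θ, Integrable (fisherIntegrand q θ)

/-- For some `ζ > 0`, the supremum of `|(log q)'''|` over `[Z - ζ, Z + ζ]` has finite
expectation when `Z` has density `q`. -/
def LogThirdDerivBound (q : ℝ → ℝ) : Prop :=
  ∃ ζ > 0, Integrable
    (fun z => ⨆ t : Set.Icc (z - ζ) (z + ζ), |iteratedDeriv 3 (fun s => Real.log (q s)) t|)
    (noise q)

instance : MeasurableSingletonClass ℤˣ :=
  ⟨fun y => ⟨{(y : ℤ)}, measurableSet_singleton _, by
    ext x; simp [Units.ext_iff]⟩⟩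

instance : IsProbabilityMeasure labelLaw := by
  unfold labelLaw; infer_instance

theorem measurable_dataMap (μ : ℝ) (d : ℕ) :
    Measurable fun p : ℤˣ × (Fin d → ℝ) =>
      (p.1, fun i => ((p.1 : ℤ) : ℝ) * μ + p.2 i) := by
  have h : Measurable fun y : ℤˣ => ((y : ℤ) : ℝ) := measurable_of_countable _
  have h1 : Measurable fun p : ℤˣ × (Fin d → ℝ) => ((p.1 : ℤ) : ℝ) := h.comp measurable_fst
  refine measurable_fst.prodMk (measurable_pi_lambda _ fun i => ?_)
  exact (h1.mul_const μ).add ((measurable_pi_apply i).comp measurable_snd)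

instance (q : ℝ → ℝ) (μ : ℝ) (d : ℕ) [IsProbabilityMeasure (noise q)] :
    IsProbabilityMeasure (dataLaw q μ d) :=
  Measure.isProbabilityMeasure_map (measurable_dataMap μ d).aemeasurable

theorem dataLaw_label_ne_zero (q : ℝ → ℝ) (μ : ℝ) (d : ℕ) [IsProbabilityMeasure (noise q)]
    (y : ℤˣ) : dataLaw q μ d {p | p.1 = y} ≠ 0 := by
  have hs : MeasurableSet {p : ℤˣ × (Fin d → ℝ) | p.1 = y} :=
    measurable_fst (measurableSet_singleton y)
  have he : (fun p : ℤˣ × (Fin d → ℝ) =>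
      ((p.1, fun i => ((p.1 : ℤ) : ℝ) * μ + p.2 i) : ℤˣ × (Fin d → ℝ))) ⁻¹'
        {p | p.1 = y} = {y} ×ˢ Set.univ := by
    ext p; simp
  rw [dataLaw, Measure.map_apply (measurable_dataMap μ d) hs, he, Measure.prod_prod, labelLaw,
    PMF.toMeasure_apply_singleton _ _ (measurableSet_singleton y)]
  simp

instance (q : ℝ → ℝ) (μ : ℝ) (d : ℕ) [IsProbabilityMeasure (noise q)] (y : ℤˣ) :
    IsProbabilityMeasure (condDataLaw q μ d y) :=
  cond_isProbabilityMeasure (dataLaw_label_ne_zero q μ d y)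

end L0Classification

end

open L0Classification

/-! Write `f = log q` and let `Λ` be the log-likelihood ratio. Given `Y = 1`, `x i - μ = z i` and `x
i + μ = z i + 2μ`, so `Λ = ∑ (f (z i) - f (z i + a / √d))` with `a = 2c`. Given `Y = -1`, `Λ` is the
negative of the same sum with `a = -2c`. One limit theorem for this sum
(`tendstoInDistribution_sum_log_sub`) thus serves both labels.

Taylor's formula splits the sum into three parts. The linear part `-(a / √d) ∑ f' (z i)` tends to
`N(0, a² I)` by the central limit theorem, since `E f' = ∫ q' = 0` and `E f'² = I`. The quadratic
part `-(a² / 2d) ∑ f'' (z i)` tends to `a² I / 2` by the law of large numbers, since `E f'' = ∫ q''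
- I = -I`. The cubic remainder is `d^(-1/2)` times a bounded average, by the assumption on `f'''`.
Slutsky's theorem adds them up.

For the Bayes error, the Neyman-Pearson lemma makes the test `Λ > 0` optimal, so the error is the
mean of `P(Λ ≤ 0 | Y = 1)` and `P(Λ > 0 | Y = -1)` (`optimalBayesError_eq`). The limits of `Λ` have
no atom at `0`, so both probabilities converge to `PhiBar` of mean over standard deviation, `2c² I /
(2c √I) = c √I`. -/

namespace L0Classification

/-! ### Derivatives of the log-density and Taylor's formula -/

section Calculus

variable {q : ℝ → ℝ}

theorem deriv_log_density (hpos : ∀ z, 0 < q z) (hq : Differentiable ℝ q) :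
    deriv (fun s => Real.log (q s)) = fun z => deriv q z / q z := by
  funext z
  exact ((hq z).hasDerivAt.log (hpos z).ne').deriv

theorem contDiff_log_density (hpos : ∀ z, 0 < q z) {n : WithTop ℕ∞} (hq : ContDiff ℝ n q) :
    ContDiff ℝ n fun s => Real.log (q s) :=
  hq.log fun z => (hpos z).ne'

theorem iteratedDeriv_two_log_density (hpos : ∀ z, 0 < q z) (hq : ContDiff ℝ 3 q) (z : ℝ) :
    iteratedDeriv 2 (fun s => Real.log (q s)) z =
      (iteratedDeriv 2 q z - deriv q z ^ 2 / q z) / q z := by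
  have hd : Differentiable ℝ q := hq.differentiable (by norm_num)
  have hdd : Differentiable ℝ (deriv q) := by
    have := hq.differentiable_iteratedDeriv 1 (by norm_num)
    rwa [iteratedDeriv_one] at this
  have hz := (hpos z).ne'
  rw [iteratedDeriv_succ, iteratedDeriv_one, deriv_log_density hpos hd, iteratedDeriv_succ,
    iteratedDeriv_one, ((hdd z).hasDerivAt.fun_div (hd z).hasDerivAt hz).deriv]
  field_simp

theorem fisherIntegrand_eq (hpos : ∀ z, 0 < q z) (hq : Differentiable ℝ q) (θ z : ℝ) :
    fisherIntegrand q θ z = deriv q (z - θ) ^ 2 / q (z - θ) := by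
  have h : HasDerivAt (fun s => Real.log (q (z - s)))
      (deriv q (z - θ) * (-1) / q (z - θ)) θ := by
    have h1 : HasDerivAt (fun s : ℝ => z - s) (-1) θ := by
      simpa using (hasDerivAt_id θ).const_sub z
    exact ((hq (z - θ)).hasDerivAt.comp θ h1).log (hpos _).ne'
  have := (hpos (z - θ)).ne'
  rw [fisherIntegrand, h.deriv]
  field_simp

/-- Lebesgue measure is translation invariant, and `θ` enters the integrand only through a shift. -/
theorem fisherInfoAt_eq_fisherInfo (hpos : ∀ z, 0 < q z) (hq : Differentiable ℝ q) (θ : ℝ) :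
    fisherInfoAt q θ = fisherInfo q := by
  simp_rw [fisherInfoAt, fisherInfo, fisherIntegrand_eq hpos hq]
  exact integral_sub_right_eq_self (fun z => deriv q z ^ 2 / q z) θ

/-- Second order Taylor expansion with the remainder bounded by the third derivative. -/
theorem abs_sub_taylor_two_le {f : ℝ → ℝ} (hf : ContDiff ℝ 3 f) {ζ z h : ℝ} (hζ : |h| ≤ ζ) :
    |f (z + h) - f z - h * deriv f z - h ^ 2 / 2 * iteratedDeriv 2 f z| ≤
      |h| ^ 3 / 6 * ⨆ t : Set.Icc (z - ζ) (z + ζ), |iteratedDeriv 3 f t| := by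
  have hle := abs_le.1 hζ
  have hcont : Continuous fun t => |iteratedDeriv 3 f t| :=
    (hf.continuous_iteratedDeriv 3 le_rfl).abs
  -- A real supremum over an unbounded family is `0` by default, so the bound by the supremum needs
  -- compactness of the interval.
  have hbdd : BddAbove (Set.range fun t : Set.Icc (z - ζ) (z + ζ) => |iteratedDeriv 3 f t|) := by
    have h := isCompact_Icc.bddAbove_image (hcont.continuousOn (s := Set.Icc (z - ζ) (z + ζ)))
    rwa [Set.image_eq_range] at h
  -- The Lagrange remainder is available only between distinct points.
  rcases eq_or_ne h 0 with rfl | hne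
  · simp
  have hx : z ≠ z + h := by simpa using hne
  obtain ⟨t, ht, hrem⟩ := taylor_mean_remainder_lagrange_iteratedDeriv (n := 2) hx
    (by exact_mod_cast hf.contDiffOn)
  have hu : UniqueDiffOn ℝ (Set.uIcc z (z + h)) := uniqueDiffOn_uIcc hx
  have hmem : z ∈ Set.uIcc z (z + h) := Set.left_mem_uIcc
  have hd (k : ℕ) (hk : k ≤ 3) :
      iteratedDerivWithin k f (Set.uIcc z (z + h)) z = iteratedDeriv k f z :=
    iteratedDerivWithin_eq_iteratedDeriv hu
      ((hf.of_le (by exact_mod_cast hk)).contDiffAt) hmem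
  have htmem : t ∈ Set.Icc (z - ζ) (z + ζ) := by
    have h1 := Set.uIoo_subset_uIcc_self ht
    have h2 : Set.uIcc z (z + h) ⊆ Set.Icc (z - ζ) (z + ζ) := by
      apply Set.uIcc_subset_Icc <;> constructor <;> linarith
    exact h2 h1
  have hsup := le_ciSup hbdd ⟨t, htmem⟩
  rw [taylorWithinEval_succ, taylorWithinEval_succ, taylor_within_zero_eval,
    hd 1 (by norm_num), hd 2 (by norm_num), iteratedDeriv_one] at hrem
  have heq : f (z + h) - f z - h * deriv f z - h ^ 2 / 2 * iteratedDeriv 2 f z =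
      h ^ 3 / 6 * iteratedDeriv 3 f t := by
    simp [Nat.factorial] at hrem
    linear_combination hrem
  rw [heq, abs_mul, abs_div, abs_pow, abs_of_pos (by norm_num : (0 : ℝ) < 6)]
  gcongr

end Calculus

/-! ### Moments of the score and of its derivative -/

section Moments

variable {q : ℝ → ℝ}

theorem integrable_noise_iff (hpos : ∀ z, 0 < q z) (hq : Continuous q) {f : ℝ → ℝ} :
    Integrable f (noise q) ↔ Integrable fun z => f z * q z := by
  rw [noise, integrable_withDensity_iff (by fun_prop) (by simp)]
  simp only [ENNReal.toReal_ofReal (hpos _).le]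

theorem integral_noise (hpos : ∀ z, 0 < q z) (hq : Continuous q) (f : ℝ → ℝ) :
    ∫ z, f z ∂(noise q) = ∫ z, f z * q z := by
  rw [noise, integral_withDensity_eq_integral_toReal_smul (by fun_prop) (by simp)]
  simp only [ENNReal.toReal_ofReal (hpos _).le, smul_eq_mul, mul_comm]

theorem FisherRegular.differentiable (hq : FisherRegular q) : Differentiable ℝ q :=
  hq.contDiff.differentiable (by norm_num)

theorem FisherRegular.integrable_sq_deriv_div (hq : FisherRegular q) :
    Integrable fun z => deriv q z ^ 2 / q z := by
  have h := hq.integrable_fisher 0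
  simpa [funext (fisherIntegrand_eq hq.pos hq.differentiable 0)] using h

theorem FisherRegular.contDiff_log (hq : FisherRegular q) : ContDiff ℝ 3 fun s => Real.log (q s) :=
  contDiff_log_density hq.pos hq.contDiff

theorem FisherRegular.memLp_score (hq : FisherRegular q) :
    MemLp (deriv fun s => Real.log (q s)) 2 (noise q) := by
  rw [memLp_two_iff_integrable_sq (measurable_deriv _).aestronglyMeasurable,
    integrable_noise_iff hq.pos hq.differentiable.continuous]
  refine hq.integrable_sq_deriv_div.congr (.of_forall fun z => ?_)
  have := (hq.pos z).ne'
  simp only [deriv_log_density hq.pos hq.differentiable]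
  field_simp

/-- The score times `q` is `q'`, whose integral vanishes. -/
theorem FisherRegular.integral_score (hq : FisherRegular q) :
    ∫ z, deriv (fun s => Real.log (q s)) z ∂(noise q) = 0 := by
  rw [integral_noise hq.pos hq.differentiable.continuous, ← hq.integral_deriv]
  congr with z
  have := (hq.pos z).ne'
  simp only [deriv_log_density hq.pos hq.differentiable]
  field_simp

theorem FisherRegular.integral_score_sq (hq : FisherRegular q) :
    ∫ z, deriv (fun s => Real.log (q s)) z ^ 2 ∂(noise q) = fisherInfo q := by
  rw [integral_noise hq.pos hq.differentiable.continuous, fisherInfo]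
  congr with z
  have := (hq.pos z).ne'
  simp only [deriv_log_density hq.pos hq.differentiable]
  field_simp

theorem FisherRegular.integrable_iteratedDeriv_two_log (hq : FisherRegular q) :
    Integrable (iteratedDeriv 2 fun s => Real.log (q s)) (noise q) := by
  rw [integrable_noise_iff hq.pos hq.differentiable.continuous]
  refine (hq.integrable_deriv2.sub hq.integrable_sq_deriv_div).congr (.of_forall fun z => ?_)
  have := (hq.pos z).ne'
  simp only [iteratedDeriv_two_log_density hq.pos hq.contDiff, Pi.sub_apply]
  field_simp

/-- The information identity: `(log q)'' q = q'' - q'² / q`, and `q''` integrates to zero. -/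
theorem FisherRegular.integral_iteratedDeriv_two_log (hq : FisherRegular q) :
    ∫ z, iteratedDeriv 2 (fun s => Real.log (q s)) z ∂(noise q) = -fisherInfo q := by
  have h : ∀ z, iteratedDeriv 2 (fun s => Real.log (q s)) z * q z =
      iteratedDeriv 2 q z - deriv q z ^ 2 / q z := fun z => by
    have := (hq.pos z).ne'
    rw [iteratedDeriv_two_log_density hq.pos hq.contDiff]
    field_simp
  rw [integral_noise hq.pos hq.differentiable.continuous]
  simp_rw [h]
  rw [integral_sub hq.integrable_deriv2 hq.integrable_sq_deriv_div, hq.integral_deriv2, zero_sub,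
    fisherInfo]

/-- If the information vanished, the continuous integrand would vanish everywhere and `q` would be a
positive constant, which has infinite mass. Positivity makes the limiting Gaussians nondegenerate.
-/
theorem FisherRegular.fisherInfo_pos [IsProbabilityMeasure (noise q)]
    (hq : FisherRegular q) : 0 < fisherInfo q := by
  have hnn : 0 ≤ fun z => deriv q z ^ 2 / q z := fun z => by
    have := hq.pos z
    positivity
  refine (integral_nonneg hnn).lt_of_ne fun h0 => ?_
  have hae := (integral_eq_zero_iff_of_nonneg hnn hq.integrable_sq_deriv_div).1 h0.symm
  have hcd : Continuous (deriv q) := hq.contDiff.continuous_deriv (by norm_num)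
  have hcont : Continuous fun z => deriv q z ^ 2 / q z :=
    (hcd.pow 2).div hq.differentiable.continuous fun z => (hq.pos z).ne'
  have hfun := (Continuous.ae_eq_iff_eq volume hcont continuous_const).1 hae
  have hderiv : ∀ z, deriv q z = 0 := fun z => by
    have : deriv q z ^ 2 / q z = 0 := congrFun hfun z
    simpa [(hq.pos z).ne'] using this
  have hconst : ∀ z, q z = q 0 := fun z => is_const_of_deriv_eq_zero hq.differentiable hderiv z 0
  have hmeas : noise q Set.univ = 1 := measure_univ
  rw [noise, withDensity_apply _ MeasurableSet.univ] at hmeas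
  simp only [hconst] at hmeas
  simp [ENNReal.mul_top, hq.pos 0] at hmeas

end Moments

end L0Classification

/-! ### Limit theorems for i.i.d. sequences -/

namespace MeasureTheory

/-- Convergence in distribution depends on the laws only. -/
theorem TendstoInDistribution.of_map_eq {ι E Ω₁ Ω₂ : Type*} {Ω Ω' : ι → Type*}
    {m : ∀ i, MeasurableSpace (Ω i)} {m' : ∀ i, MeasurableSpace (Ω' i)}
    {m₁ : MeasurableSpace Ω₁} {m₂ : MeasurableSpace Ω₂}
    {μ : ∀ i, Measure (Ω i)} [∀ i, IsProbabilityMeasure (μ i)]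
    {ν : ∀ i, Measure (Ω' i)} [∀ i, IsProbabilityMeasure (ν i)]
    {μ₁ : Measure Ω₁} [IsProbabilityMeasure μ₁] {μ₂ : Measure Ω₂} [IsProbabilityMeasure μ₂]
    [TopologicalSpace E] [MeasurableSpace E] [OpensMeasurableSpace E]
    {X : ∀ i, Ω i → E} {Y : ∀ i, Ω' i → E} {Z : Ω₁ → E} {W : Ω₂ → E} {l : Filter ι}
    (h : TendstoInDistribution X l Z μ μ₁) (hY : ∀ i, AEMeasurable (Y i) (ν i))
    (hW : AEMeasurable W μ₂) (hXY : ∀ i, (μ i).map (X i) = (ν i).map (Y i))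
    (hZW : μ₁.map Z = μ₂.map W) : TendstoInDistribution Y l W ν μ₂ where
  forall_aemeasurable := hY
  aemeasurable_limit := hW
  tendsto := by
    have h1 := h.tendsto
    simp only [hXY, hZW] at h1
    exact h1

end MeasureTheory

namespace ProbabilityTheory

/-- The averages of i.i.d. copies of an integrable function converge almost surely. -/
theorem ae_tendsto_average_infinitePi {E : Type*} [MeasurableSpace E] (ν : Measure E)
    [IsProbabilityMeasure ν] {f : E → ℝ} (hf : Integrable f ν) :
    ∀ᵐ ω ∂(Measure.infinitePi fun _ : ℕ => ν),
      Tendsto (fun d : ℕ => (∑ i ∈ Finset.range d, f (ω i)) / d) atTop (𝓝 (∫ z, f z ∂ν)) := by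
  have hmp (i : ℕ) := measurePreserving_eval_infinitePi (fun _ : ℕ => ν) i
  have hind : iIndepFun (fun (i : ℕ) (ω : ℕ → E) => ω i) (Measure.infinitePi fun _ : ℕ => ν) :=
    iIndepFun_infinitePi (X := fun _ x => x) fun _ => measurable_id
  -- Integrability gives only a.e. measurability of `f`, which must be carried to the law of each
  -- coordinate. This generality admits the supremum of the third derivative as `f`.
  have hfm (i : ℕ) : AEMeasurable f
      ((Measure.infinitePi fun _ : ℕ => ν).map fun ω : ℕ → E => ω i) := by
    rw [(hmp i).map_eq]
    exact hf.aemeasurable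
  have hlaw := strong_law_ae_real (μ := Measure.infinitePi fun _ : ℕ => ν)
    (fun (i : ℕ) (ω : ℕ → E) => f (ω i)) ((hmp 0).integrable_comp_of_integrable hf)
    (fun i j hij => (hind.indepFun hij).comp₀ (hmp i).aemeasurable (hmp j).aemeasurable
      (hfm i) (hfm j))
    (fun i => IdentDistrib.comp_of_aemeasurable
      ⟨(hmp i).aemeasurable, (hmp 0).aemeasurable, by rw [(hmp i).map_eq, (hmp 0).map_eq]⟩ (hfm i))
  rwa [← integral_map (φ := fun ω : ℕ → E => ω 0) (hmp 0).aemeasurable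
    (hfm 0).aestronglyMeasurable, (hmp 0).map_eq] at hlaw

/-- The central limit theorem for i.i.d. copies of a centered square integrable function. -/
theorem tendstoInDistribution_inv_sqrt_mul_sum_infinitePi {E : Type*} [MeasurableSpace E]
    (ν : Measure E) [IsProbabilityMeasure ν] {f : E → ℝ} (hfm : Measurable f) (hf : MemLp f 2 ν)
    (hmean : ∫ z, f z ∂ν = 0) :
    TendstoInDistribution
      (fun (d : ℕ) (ω : ℕ → E) => (√d)⁻¹ * ∑ i ∈ Finset.range d, f (ω i)) atTop (fun w : ℝ => w)
      (fun _ => Measure.infinitePi fun _ : ℕ => ν)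
      (gaussianReal 0 (∫ z, f z ^ 2 ∂ν).toNNReal) := by
  have hmp (i : ℕ) := measurePreserving_eval_infinitePi (fun _ : ℕ => ν) i
  have hvar : Var[fun ω : ℕ → E => f (ω 0); Measure.infinitePi fun _ : ℕ => ν] =
      ∫ z, f z ^ 2 ∂ν := by
    have h1 := variance_map (X := f) (Y := fun ω : ℕ → E => ω 0)
      (μ := Measure.infinitePi fun _ : ℕ => ν) hfm.aemeasurable (hmp 0).aemeasurable
    rw [(hmp 0).map_eq] at h1
    rw [← variance_of_integral_eq_zero hfm.aemeasurable hmean, h1]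
    rfl
  have hint : ∫ ω, f (ω 0) ∂(Measure.infinitePi fun _ : ℕ => ν) = 0 := by
    rw [← integral_map (φ := fun ω : ℕ → E => ω 0) (hmp 0).aemeasurable
      hfm.aestronglyMeasurable, (hmp 0).map_eq, hmean]
  have h := tendstoInDistribution_inv_sqrt_mul_sum_sub (P := Measure.infinitePi fun _ : ℕ => ν)
    (P' := gaussianReal 0 (∫ z, f z ^ 2 ∂ν).toNNReal) (X := fun i ω => f (ω i))
    (Y := fun w : ℝ => w) ⟨by fun_prop, by rw [hvar]; exact Measure.map_id⟩
    (hf.comp_measurePreserving (hmp 0)) (iIndepFun_infinitePi (X := fun _ => f) fun _ => hfm)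
    (fun i => IdentDistrib.comp
      ⟨(hmp i).aemeasurable, (hmp 0).aemeasurable, by rw [(hmp i).map_eq, (hmp 0).map_eq]⟩ hfm)
  simpa only [hint, mul_zero, sub_zero] using h

end ProbabilityTheory

/-! ### Asymptotic normality of the log-density increments -/

namespace L0Classification

variable {q : ℝ → ℝ}

/-- The increments of the log-density, after removal of the linear term, have a deterministic
limit by the law of large numbers. -/
theorem ae_tendsto_sum_log_sub [IsProbabilityMeasure (noise q)] (h1 : FisherRegular q)
    (h2 : LogThirdDerivBound q) (a : ℝ) :
    ∀ᵐ ω ∂(Measure.infinitePi fun _ : ℕ => noise q),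
      Tendsto (fun d : ℕ => ∑ i ∈ Finset.range d,
        (Real.log (q (ω i)) - Real.log (q (ω i + a / √d)) +
          a / √d * deriv (fun s => Real.log (q s)) (ω i)))
        atTop (𝓝 (a ^ 2 / 2 * fisherInfo q)) := by
  obtain ⟨ζ, hζ, hM⟩ := h2
  set M : ℝ → ℝ := fun z =>
    ⨆ t : Set.Icc (z - ζ) (z + ζ), |iteratedDeriv 3 (fun s => Real.log (q s)) t|
  set f : ℝ → ℝ := fun s => Real.log (q s) with hf
  have hsqrt : Tendsto (fun d : ℕ => a / √(d : ℝ)) atTop (𝓝 0) :=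
    tendsto_const_nhds.div_atTop (Real.tendsto_sqrt_atTop.comp tendsto_natCast_atTop_atTop)
  filter_upwards [ae_tendsto_average_infinitePi _ hM,
    ae_tendsto_average_infinitePi _ h1.integrable_iteratedDeriv_two_log] with ω hω1 hω2
  rw [h1.integral_iteratedDeriv_two_log] at hω2
  have hmain : Tendsto (fun d : ℕ => -(a ^ 2 / 2) *
      ((∑ i ∈ Finset.range d, iteratedDeriv 2 f (ω i)) / d)) atTop
      (𝓝 (a ^ 2 / 2 * fisherInfo q)) := by
    have := hω2.const_mul (-(a ^ 2 / 2))
    rwa [neg_mul_neg] at this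
  -- Each Taylor remainder is at most `|a / √d| ^ 3 / 6 * M (ω i)`. One factor `|a / √d| ^ 2 = a ^ 2
  -- / d` turns the sum of the `M (ω i)` into an average, which converges, and the leftover `|a /
  -- √d|` tends to zero.
  have hbound : Tendsto (fun d : ℕ => a ^ 2 * |a / √(d : ℝ)| / 6 *
      ((∑ i ∈ Finset.range d, M (ω i)) / d)) atTop (𝓝 0) := by
    have h3 : Tendsto (fun d : ℕ => a ^ 2 * |a / √(d : ℝ)| / 6) atTop (𝓝 0) := by
      simpa using (hsqrt.abs.const_mul (a ^ 2)).div_const 6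
    simpa using h3.mul hω1
  have hrem : Tendsto (fun d : ℕ => ∑ i ∈ Finset.range d,
      (f (ω i + a / √d) - f (ω i) - a / √d * deriv f (ω i) -
        (a / √d) ^ 2 / 2 * iteratedDeriv 2 f (ω i))) atTop (𝓝 0) := by
    refine squeeze_zero_norm' ?_ hbound
    -- The Taylor bound applies once the shift `a / √d` is at most `ζ` in absolute value.
    filter_upwards [hsqrt.abs.eventually_le_const (u := ζ) (by simpa using hζ),
      eventually_gt_atTop 0] with d hd hd0
    have hd' : (0 : ℝ) < d := by exact_mod_cast hd0
    have hsq : |a / √(d : ℝ)| ^ 2 = a ^ 2 / d := by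
      rw [sq_abs, div_pow, Real.sq_sqrt hd'.le]
    calc _ ≤ ∑ i ∈ Finset.range d, |a / √(d : ℝ)| ^ 3 / 6 * M (ω i) :=
          (norm_sum_le _ _).trans
            (Finset.sum_le_sum fun i _ => abs_sub_taylor_two_le h1.contDiff_log hd)
      _ = _ := by
          rw [← Finset.mul_sum, pow_succ, hsq]
          field_simp
  have hsum := hmain.sub hrem
  rw [sub_zero] at hsum
  refine hsum.congr' ?_
  filter_upwards [eventually_gt_atTop 0] with d hd0
  have hd' : (0 : ℝ) < d := by exact_mod_cast hd0
  have hsq : (a / √(d : ℝ)) ^ 2 = a ^ 2 / d := by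
    rw [div_pow, Real.sq_sqrt hd'.le]
  have hl : -(a ^ 2 / 2) * ((∑ i ∈ Finset.range d, iteratedDeriv 2 f (ω i)) / d) =
      ∑ i ∈ Finset.range d, -((a / √(d : ℝ)) ^ 2 / 2 * iteratedDeriv 2 f (ω i)) := by
    rw [hsq, Finset.sum_neg_distrib, ← Finset.mul_sum]
    field_simp
  rw [hl, ← Finset.sum_sub_distrib]
  refine Finset.sum_congr rfl fun i _ => ?_
  simp only [hf]
  ring

/-- The sum of the increments of the log-density along i.i.d. noise is asymptotically normal. -/
theorem tendstoInDistribution_sum_log_sub [IsProbabilityMeasure (noise q)] (h1 : FisherRegular q)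
    (h2 : LogThirdDerivBound q) (a : ℝ) :
    TendstoInDistribution
      (fun (d : ℕ) (ω : ℕ → ℝ) =>
        ∑ i ∈ Finset.range d, (Real.log (q (ω i)) - Real.log (q (ω i + a / √d))))
      atTop (fun w : ℝ => w) (fun _ => Measure.infinitePi fun _ : ℕ => noise q)
      (gaussianReal (a ^ 2 / 2 * fisherInfo q) (a ^ 2 * fisherInfo q).toNNReal) := by
  have hlog : Measurable fun s => Real.log (q s) := h1.contDiff_log.continuous.measurable
  have hderiv : Measurable (deriv fun s => Real.log (q s)) := measurable_deriv _
  have hclt := (tendstoInDistribution_inv_sqrt_mul_sum_infinitePi (noise q) hderiv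
    h1.memLp_score h1.integral_score).continuous_comp (g := fun x => -a * x) (by fun_prop)
  have hmeas (d : ℕ) : Measurable fun ω : ℕ → ℝ => ∑ i ∈ Finset.range d,
      (Real.log (q (ω i)) - Real.log (q (ω i + a / √d)) +
        a / √d * deriv (fun s => Real.log (q s)) (ω i)) :=
    Finset.measurable_sum _ fun i _ =>
      ((hlog.comp (measurable_pi_apply i)).sub
        (hlog.comp ((measurable_pi_apply i).add_const _))).add
        ((hderiv.comp (measurable_pi_apply i)).const_mul _)
  -- Slutsky's theorem: the increments minus their linear part converge almost surely to a constant,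
  -- so they only shift the Gaussian limit of the linear part.
  have hadd := hclt.add_of_tendstoInMeasure_const
    (tendstoInMeasure_of_tendsto_ae (fun d => (hmeas d).aestronglyMeasurable)
      (ae_tendsto_sum_log_sub h1 h2 a)) fun d => (hmeas d).aemeasurable
  refine hadd.of_map_eq (fun d => Measurable.aemeasurable ?_) (by fun_prop) (fun d => ?_) ?_
  · exact Finset.measurable_sum _ fun i _ =>
      (hlog.comp (measurable_pi_apply i)).sub (hlog.comp ((measurable_pi_apply i).add_const _))
  · congr 1
    funext ω
    simp only [Pi.add_apply, Function.comp_apply, Finset.sum_add_distrib, ← Finset.mul_sum]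
    ring
  · have hcomp : (fun ω : ℝ => ((fun x => -a * x) ∘ fun w : ℝ => w) ω + a ^ 2 / 2 * fisherInfo q) =
        (· + a ^ 2 / 2 * fisherInfo q) ∘ (-a * ·) := rfl
    rw [hcomp, ← Measure.map_map (by fun_prop) (by fun_prop), gaussianReal_map_const_mul,
      gaussianReal_map_add_const, h1.integral_score_sq]
    erw [Measure.map_id]
    congr 1
    · ring
    · rw [Real.toNNReal_mul (sq_nonneg a)]
      congr 1
      ext
      simp [sq_nonneg]

end L0Classification

/-! ### Product densities and the likelihood ratio test -/

namespace MeasureTheory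

/-- A product of probability measures with densities has the product density. -/
theorem Measure.pi_withDensity {ι : Type*} [Fintype ι] {X : ι → Type*}
    [∀ i, MeasurableSpace (X i)] (ν : ∀ i, Measure (X i)) [∀ i, IsProbabilityMeasure (ν i)]
    {f : ∀ i, X i → ENNReal} (hf : ∀ i, Measurable (f i))
    [∀ i, SigmaFinite ((ν i).withDensity (f i))] :
    Measure.pi (fun i => (ν i).withDensity (f i)) =
      (Measure.pi ν).withDensity fun x => ∏ i, f i (x i) := by
  refine Measure.pi_eq fun s hs => ?_
  -- On a box the integrand factors over the coordinates, so independence under the product measure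
  -- splits the integral.
  have hind (x : ∀ i, X i) : (Set.univ.pi s).indicator (fun x => ∏ i, f i (x i)) x =
      ∏ i, (s i).indicator (f i) (x i) := by
    classical
    by_cases hx : x ∈ Set.univ.pi s
    · rw [Set.indicator_of_mem hx]
      exact Finset.prod_congr rfl fun i _ => (Set.indicator_of_mem (hx i trivial) _).symm
    · rw [Set.indicator_of_notMem hx]
      obtain ⟨i, hi⟩ : ∃ i, x i ∉ s i := by simpa [Set.mem_pi] using hx
      exact (Finset.prod_eq_zero (Finset.mem_univ i) (Set.indicator_of_notMem hi _)).symm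
  have hm (i : ι) : Measurable ((s i).indicator (f i)) := (hf i).indicator (hs i)
  have hmp (i : ι) := measurePreserving_eval ν i
  rw [withDensity_apply _ (MeasurableSet.univ_pi hs),
    ← lintegral_indicator (MeasurableSet.univ_pi hs)]
  simp_rw [hind]
  rw [lintegral_prod_eq_prod_lintegral_of_indepFun _ (fun i (x : ∀ i, X i) =>
    (s i).indicator (f i) (x i)) (iIndepFun_pi fun i => (hm i).aemeasurable)
    fun i => (hm i).comp (measurable_pi_apply i)]
  refine Finset.prod_congr rfl fun i _ => ?_
  rw [withDensity_apply _ (hs i), ← lintegral_indicator (hs i)]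
  exact (hmp i).lintegral_comp (hm i)

/-- **Neyman-Pearson lemma** for equal costs: the likelihood ratio test minimizes the sum of the
two error probabilities. -/
theorem measureReal_likelihoodRatio_le {Ω : Type*} [MeasurableSpace Ω] (ν : Measure Ω)
    [IsFiniteMeasure ν] {L : Ω → ℝ} (hL : Measurable L)
    [IsFiniteMeasure (ν.withDensity fun x => ENNReal.ofReal (Real.exp (L x)))]
    {B : Set Ω} (hB : MeasurableSet B) :
    (ν.withDensity fun x => ENNReal.ofReal (Real.exp (L x))).real {x | L x ≤ 0} +
        ν.real {x | 0 < L x} ≤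
      (ν.withDensity fun x => ENNReal.ofReal (Real.exp (L x))).real Bᶜ + ν.real B := by
  set ρ := ν.withDensity fun x => ENNReal.ofReal (Real.exp (L x))
  set A := {x | 0 < L x}
  have hA : MeasurableSet A := measurableSet_lt measurable_const hL
  have hAc : {x | L x ≤ 0} = Aᶜ := by ext; simp [A]
  -- The tests `A` and `B` differ only on `B \ A`, where the density of `ρ` is at most one, and on
  -- `A \ B`, where it is at least one. Replacing `B` by `A` therefore cannot increase the total
  -- error.
  have hle : ρ.real (B \ A) ≤ ν.real (B \ A) := by
    refine ENNReal.toReal_mono (measure_ne_top _ _) ?_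
    rw [withDensity_apply _ (hB.diff hA), ← setLIntegral_one]
    refine setLIntegral_mono measurable_const fun x hx => ?_
    rw [ENNReal.ofReal_le_one, Real.exp_le_one_iff]
    exact not_lt.1 hx.2
  have hge : ν.real (A \ B) ≤ ρ.real (A \ B) := by
    refine ENNReal.toReal_mono (measure_ne_top _ _) ?_
    rw [withDensity_apply _ (hA.diff hB), ← setLIntegral_one]
    refine setLIntegral_mono (by fun_prop) fun x hx => ?_
    rw [ENNReal.one_le_ofReal, Real.one_le_exp_iff]
    exact (show 0 < L x from hx.1).le
  have e1 := measureReal_sdiff_add_inter (μ := ρ) (s := A) hB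
  have e2 := measureReal_sdiff_add_inter (μ := ρ) (s := B) hA
  have e3 := measureReal_sdiff_add_inter (μ := ν) (s := A) hB
  have e4 := measureReal_sdiff_add_inter (μ := ν) (s := B) hA
  rw [Set.inter_comm] at e2 e4
  rw [hAc, measureReal_compl hA, measureReal_compl hB]
  linarith

end MeasureTheory

/-! ### Laws of the features given the label -/

namespace L0Classification

variable {q : ℝ → ℝ}

/-- The law of the features `m + z i`. -/
noncomputable def featureLaw (q : ℝ → ℝ) (m : ℝ) (d : ℕ) : Measure (Fin d → ℝ) :=
  Measure.pi fun _ => (noise q).map fun z => m + z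

instance [IsProbabilityMeasure (noise q)] (m : ℝ) :
    IsProbabilityMeasure ((noise q).map fun z => m + z) :=
  Measure.isProbabilityMeasure_map (by fun_prop)

instance [IsProbabilityMeasure (noise q)] (m : ℝ) (d : ℕ) :
    IsProbabilityMeasure (featureLaw q m d) := by
  unfold featureLaw; infer_instance

theorem map_add_noise (hq : Measurable q) (m : ℝ) :
    (noise q).map (fun z => m + z) = volume.withDensity fun x => ENNReal.ofReal (q (x - m)) := by
  ext s hs
  rw [noise, Measure.map_apply (by fun_prop) hs,
    withDensity_apply _ (measurableSet_preimage (by fun_prop) hs), withDensity_apply _ hs,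
    ← (measurePreserving_add_left volume m).setLIntegral_comp_preimage hs (by fun_prop)]
  simp

theorem map_add_noise_eq_withDensity (hpos : ∀ z, 0 < q z) (hq : Measurable q) (m : ℝ) :
    (noise q).map (fun z => m + z) = ((noise q).map fun z => -m + z).withDensity
      fun x => ENNReal.ofReal (q (x - m) / q (x + m)) := by
  rw [map_add_noise hq, map_add_noise hq, ← withDensity_mul _ (by fun_prop) (by fun_prop)]
  congr with x
  rw [Pi.mul_apply, ← ENNReal.ofReal_mul (hpos _).le, sub_neg_eq_add,
    mul_div_cancel₀ _ (hpos _).ne']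

theorem measurable_logLikelihood (hq : Measurable q) (μ : ℝ) (d : ℕ) :
    Measurable (logLikelihood q μ : (Fin d → ℝ) → ℝ) := by
  unfold logLikelihood
  fun_prop

theorem featureLaw_eq_withDensity [IsProbabilityMeasure (noise q)] (hpos : ∀ z, 0 < q z)
    (hq : Measurable q) (μ : ℝ) (d : ℕ) :
    featureLaw q μ d = (featureLaw q (-μ) d).withDensity
      fun x => ENNReal.ofReal (Real.exp (logLikelihood q μ x)) := by
  have hfin : SigmaFinite (((noise q).map fun z => -μ + z).withDensity
      fun x => ENNReal.ofReal (q (x - μ) / q (x + μ))) := by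
    rw [← map_add_noise_eq_withDensity hpos hq]
    infer_instance
  have h := Measure.pi_withDensity (ι := Fin d) (fun _ => (noise q).map fun z => -μ + z)
    (f := fun _ x => ENNReal.ofReal (q (x - μ) / q (x + μ))) fun _ => by fun_prop
  rw [featureLaw, map_add_noise_eq_withDensity hpos hq, h, featureLaw]
  congr with x
  have hp (i : Fin d) : 0 < q (x i - μ) / q (x i + μ) := div_pos (hpos _) (hpos _)
  rw [logLikelihood, Real.exp_sum, ENNReal.ofReal_prod_of_nonneg fun i _ => (Real.exp_pos _).le]
  simp_rw [Real.exp_log (hp _)]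

/-- On the slice of label `y` the data map is the translation by `y * μ`; the factor `2⁻¹` is the
probability of the label. -/
theorem dataLaw_label_inter [IsProbabilityMeasure (noise q)] (μ : ℝ) (d : ℕ) (y : ℤˣ)
    {A : Set (Fin d → ℝ)} (hA : MeasurableSet A) :
    dataLaw q μ d {p | p.1 = y ∧ p.2 ∈ A} = 2⁻¹ * featureLaw q (((y : ℤ) : ℝ) * μ) d A := by
  have hs : MeasurableSet {p : ℤˣ × (Fin d → ℝ) | p.1 = y ∧ p.2 ∈ A} :=
    (measurable_fst (measurableSet_singleton y)).inter (measurable_snd hA)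
  have hf : Measurable fun (z : Fin d → ℝ) i => ((y : ℤ) : ℝ) * μ + z i := by fun_prop
  have he : (fun p : ℤˣ × (Fin d → ℝ) =>
      ((p.1, fun i => ((p.1 : ℤ) : ℝ) * μ + p.2 i) : ℤˣ × (Fin d → ℝ))) ⁻¹'
        {p | p.1 = y ∧ p.2 ∈ A} =
      {y} ×ˢ ((fun (z : Fin d → ℝ) i => ((y : ℤ) : ℝ) * μ + z i) ⁻¹' A) := by
    ext ⟨u, z⟩
    simp only [Set.mem_preimage, Set.mem_ofPred_eq, Set.mem_prod, Set.mem_singleton_iff]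
    exact and_congr_right fun h => by rw [h]
  rw [dataLaw, Measure.map_apply (measurable_dataMap μ d) hs, he, Measure.prod_prod, labelLaw,
    PMF.toMeasure_apply_singleton _ _ (measurableSet_singleton y), ← Measure.map_apply hf hA,
    featureLaw, Measure.pi_map_pi (μ := fun _ : Fin d => noise q)
      (f := fun _ z => ((y : ℤ) : ℝ) * μ + z) fun _ => by fun_prop]
  simp

theorem map_snd_condDataLaw [IsProbabilityMeasure (noise q)] (μ : ℝ) (d : ℕ) (y : ℤˣ) :
    (condDataLaw q μ d y).map Prod.snd = featureLaw q (((y : ℤ) : ℝ) * μ) d := by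
  have hs : MeasurableSet {p : ℤˣ × (Fin d → ℝ) | p.1 = y} :=
    measurable_fst (measurableSet_singleton y)
  ext A hA
  have h1 := dataLaw_label_inter (q := q) μ d y MeasurableSet.univ
  have h2 := dataLaw_label_inter (q := q) μ d y hA
  simp only [Set.mem_univ, and_true, measure_univ, mul_one] at h1
  rw [Measure.map_apply measurable_snd hA, condDataLaw, cond_apply hs, h1, inv_inv]
  change 2 * dataLaw q μ d {p | p.1 = y ∧ p.2 ∈ A} = _
  rw [h2, ← mul_assoc, ENNReal.mul_inv_cancel two_ne_zero ENNReal.ofNat_ne_top, one_mul]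

/-- Realizes the features of every dimension on one space of infinite noise sequences, where the
limit theorems are stated. -/
theorem map_infinitePi_eq_featureLaw [IsProbabilityMeasure (noise q)] (m : ℝ) (d : ℕ) :
    (Measure.infinitePi fun _ : ℕ => noise q).map (fun ω (i : Fin d) => m + ω i) =
      featureLaw q m d := by
  have hmp (i : ℕ) := measurePreserving_eval_infinitePi (fun _ : ℕ => noise q) i
  have hind := (iIndepFun_infinitePi (P := fun _ : ℕ => noise q) (X := fun _ z => m + z)
    fun _ => by fun_prop).precomp (g := fun i : Fin d => (i : ℕ)) Fin.val_injective
  rw [iIndepFun_iff_map_fun_eq_pi_map fun i : Fin d =>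
    ((hmp i).measurable.const_add m).aemeasurable] at hind
  rw [hind, featureLaw]
  congr with i : 1
  have h := Measure.map_map (μ := Measure.infinitePi fun _ : ℕ => noise q)
    (g := fun z => m + z) (by fun_prop) (hmp i).measurable
  rw [(hmp i).map_eq] at h
  exact h.symm

/-! ### The Bayes error as the error of the likelihood ratio test -/

section BayesError

theorem l0Ball_zero {d : ℕ} (x : Fin d → ℝ) : l0Ball x 0 = {x} := by
  ext x'
  simp only [l0Ball, l0Norm, Set.mem_ofPred_eq, Set.mem_singleton_iff, Nat.le_zero,
    Set.ncard_eq_zero (Set.toFinite _), Set.eq_empty_iff_forall_notMem, Pi.sub_apply, ne_eq,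
    not_not, sub_eq_zero]
  exact ⟨fun h => funext fun i => (h i).symm, fun h i => by rw [h]⟩

/-- Without budget the adversary's ball is a single point, so the supremum is the plain loss, and
the error event splits according to the label. -/
theorem robustError_zero [IsProbabilityMeasure (noise q)] (μ : ℝ) (d : ℕ)
    {C : (Fin d → ℝ) → ℤˣ} (hC : Measurable C) :
    robustError q μ d C 0 = 2⁻¹ *
      ((featureLaw q μ d).real {x | C x = 1}ᶜ + (featureLaw q (-μ) d).real {x | C x = 1}) := by
  have hA : MeasurableSet {x | C x = 1} := hC (measurableSet_singleton 1)
  have hsets : {p : ℤˣ × (Fin d → ℝ) | C p.2 ≠ p.1} =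
      {p | p.1 = 1 ∧ p.2 ∈ {x | C x = 1}ᶜ} ∪ {p | p.1 = -1 ∧ p.2 ∈ {x | C x = 1}} := by
    ext ⟨y, x⟩
    rcases Int.units_eq_one_or y with rfl | rfl <;>
      rcases Int.units_eq_one_or (C x) with h | h <;> simp [h]
  have hm1 : MeasurableSet {p : ℤˣ × (Fin d → ℝ) | p.1 = 1 ∧ p.2 ∈ {x | C x = 1}ᶜ} :=
    (measurable_fst (measurableSet_singleton 1)).inter (measurable_snd hA.compl)
  have hm2 : MeasurableSet {p : ℤˣ × (Fin d → ℝ) | p.1 = -1 ∧ p.2 ∈ {x | C x = 1}} :=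
    (measurable_fst (measurableSet_singleton (-1))).inter (measurable_snd hA)
  have hdisj : Disjoint {p : ℤˣ × (Fin d → ℝ) | p.1 = 1 ∧ p.2 ∈ {x | C x = 1}ᶜ}
      {p | p.1 = -1 ∧ p.2 ∈ {x | C x = 1}} :=
    Set.disjoint_left.2 fun p hp hp' => hp.2 hp'.2
  have hloss (p : ℤˣ × (Fin d → ℝ)) : ⨆ x' : l0Ball p.2 0, loss C x' p.1 =
      {p : ℤˣ × (Fin d → ℝ) | C p.2 ≠ p.1}.indicator 1 p := by
    have : Unique (l0Ball p.2 0) := by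
      rw [l0Ball_zero]
      infer_instance
    have hdef : ((default : l0Ball p.2 0) : Fin d → ℝ) = p.2 := by
      have h := (default : l0Ball p.2 0).2
      generalize ((default : l0Ball p.2 0) : Fin d → ℝ) = x at h
      rwa [l0Ball_zero] at h
    rw [ciSup_unique, hdef]
    simp [loss, Set.indicator_apply]
  rw [robustError, integral_congr_ae (.of_forall hloss), hsets,
    integral_indicator_one (hm1.union hm2), measureReal_union hdisj hm2, measureReal_def,
    measureReal_def, dataLaw_label_inter μ d 1 hA.compl, dataLaw_label_inter μ d (-1) hA]
  simp [measureReal_def, mul_add]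

/-- The Neyman-Pearson lemma, applied to the region where a classifier answers `1`, gives the lower
bound; the likelihood ratio classifier attains it. -/
theorem optimalBayesError_eq [IsProbabilityMeasure (noise q)] (hpos : ∀ z, 0 < q z)
    (hq : Measurable q) (μ : ℝ) (d : ℕ) :
    optimalBayesError q μ d = 2⁻¹ *
      ((featureLaw q μ d).real {x | logLikelihood q μ x ≤ 0} +
        (featureLaw q (-μ) d).real {x | 0 < logLikelihood q μ x}) := by
  classical
  have hL := measurable_logLikelihood hq μ d
  have hA : MeasurableSet {x : Fin d → ℝ | 0 < logLikelihood q μ x} :=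
    measurableSet_lt measurable_const hL
  have hlower (C : {C : (Fin d → ℝ) → ℤˣ // Measurable C}) :
      2⁻¹ * ((featureLaw q μ d).real {x | logLikelihood q μ x ≤ 0} +
        (featureLaw q (-μ) d).real {x | 0 < logLikelihood q μ x}) ≤ robustError q μ d C 0 := by
    have heq := featureLaw_eq_withDensity hpos hq μ d
    have : IsFiniteMeasure ((featureLaw q (-μ) d).withDensity
        fun x => ENNReal.ofReal (Real.exp (logLikelihood q μ x))) := by
      rw [← heq]
      infer_instance
    rw [robustError_zero μ d C.2]
    have hle := measureReal_likelihoodRatio_le (featureLaw q (-μ) d) hL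
      (C.2 (measurableSet_singleton 1))
    rw [← heq] at hle
    exact mul_le_mul_of_nonneg_left hle (by norm_num)
  -- Ties go to `-1`, in accordance with the weak inequality in the first error term.
  set C₀ : (Fin d → ℝ) → ℤˣ := fun x => if 0 < logLikelihood q μ x then 1 else -1
  have hC₀ : Measurable C₀ := Measurable.ite hA measurable_const measurable_const
  have hset : {x | C₀ x = 1} = {x | 0 < logLikelihood q μ x} := by
    ext x
    by_cases h : 0 < logLikelihood q μ x <;> simp [C₀, h]
  have hcompl : {x : Fin d → ℝ | 0 < logLikelihood q μ x}ᶜ = {x | logLikelihood q μ x ≤ 0} := by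
    ext x
    simp
  have : Nonempty {C : (Fin d → ℝ) → ℤˣ // Measurable C} := ⟨⟨C₀, hC₀⟩⟩
  refine le_antisymm ?_ (le_ciInf hlower)
  refine (ciInf_le ⟨_, Set.forall_mem_range.2 hlower⟩ ⟨C₀, hC₀⟩).trans_eq ?_
  rw [robustError_zero μ d hC₀, hset, hcompl]

end BayesError

/-! ### Gaussian tails and convergence of probabilities -/

section Gaussian

theorem gaussianReal_real_Ioi (x : ℝ) : (gaussianReal 0 1).real (Set.Ioi x) = PhiBar x := by
  rw [measureReal_def, gaussianReal_apply_eq_integral _ one_ne_zero,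
    ENNReal.toReal_ofReal (integral_nonneg fun _ => gaussianPDFReal_nonneg _ _ _), PhiBar,
    ← integral_const_mul]
  simp [gaussianPDFReal]

/-- Standardization: `s * x - m` is positive exactly when `x > m / s`. -/
theorem gaussianReal_neg_real_Ioi_zero (m : ℝ) {s : ℝ} (hs : 0 < s) :
    (gaussianReal (-m) (s ^ 2).toNNReal).real (Set.Ioi 0) = PhiBar (m / s) := by
  have hmap : gaussianReal (-m) (s ^ 2).toNNReal = (gaussianReal 0 1).map fun x => s * x + -m := by
    have hcomp : (fun x => s * x + -m) = (· + -m) ∘ (s * ·) := rfl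
    rw [hcomp, ← Measure.map_map (by fun_prop) (by fun_prop), gaussianReal_map_const_mul,
      gaussianReal_map_add_const]
    congr 1
    · ring
    · ext
      simp [sq_nonneg]
  rw [hmap, map_measureReal_apply (by fun_prop) measurableSet_Ioi, ← gaussianReal_real_Ioi]
  congr 1
  ext x
  simp [div_lt_iff₀' hs]

/-- Reflection reduces this to the opposite mean; the endpoint does not matter because the Gaussian
has no atoms. -/
theorem gaussianReal_real_Iic_zero (m : ℝ) {s : ℝ} (hs : 0 < s) :
    (gaussianReal m (s ^ 2).toNNReal).real (Set.Iic 0) = PhiBar (m / s) := by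
  have hv : (s ^ 2).toNNReal ≠ 0 := by simpa using hs.ne'
  have := nullSingletonClass_gaussianReal (μ := -m) hv
  have hmap := gaussianReal_map_neg (μ := -m) (v := (s ^ 2).toNNReal)
  rw [neg_neg] at hmap
  have hpre : (fun x : ℝ => -x) ⁻¹' Set.Iic 0 = Set.Ici 0 := by
    ext
    simp
  rw [← gaussianReal_neg_real_Ioi_zero m hs, ← hmap,
    map_measureReal_apply (by fun_prop) measurableSet_Iic, hpre]
  exact measureReal_congr Ioi_ae_eq_Ici.symm

/-- The portmanteau theorem for sets whose frontier is null under the limit law. -/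
theorem _root_.MeasureTheory.TendstoInDistribution.tendsto_real_preimage {ι E Ω₁ : Type*}
    {Ω : ι → Type*} {m : ∀ i, MeasurableSpace (Ω i)} {m₁ : MeasurableSpace Ω₁}
    {μ : ∀ i, Measure (Ω i)} [∀ i, IsProbabilityMeasure (μ i)]
    {μ₁ : Measure Ω₁} [IsProbabilityMeasure μ₁]
    [TopologicalSpace E] [MeasurableSpace E] [OpensMeasurableSpace E] [HasOuterApproxClosed E]
    {X : ∀ i, Ω i → E} {Z : Ω₁ → E} {l : Filter ι}
    (h : TendstoInDistribution X l Z μ μ₁) {s : Set E} (hs : (μ₁.map Z) (frontier s) = 0) :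
    Tendsto (fun i => ((μ i).map (X i)).real s) l (𝓝 ((μ₁.map Z).real s)) :=
  (ENNReal.tendsto_toReal (measure_ne_top _ _)).comp
    (ProbabilityMeasure.tendsto_measure_of_null_frontier_of_tendsto' h.tendsto hs)

end Gaussian

/-! ### Limits of the log-likelihood ratio and of the Bayes error -/

section Asymptotics

variable [IsProbabilityMeasure (noise q)]

theorem map_logLikelihood_featureLaw (hq : Measurable q) (μ m : ℝ) (d : ℕ) :
    (featureLaw q m d).map (logLikelihood q μ) =
      (Measure.infinitePi fun _ : ℕ => noise q).map fun ω =>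
        ∑ i ∈ Finset.range d, Real.log (q (m + ω i - μ) / q (m + ω i + μ)) := by
  rw [← map_infinitePi_eq_featureLaw, Measure.map_map (measurable_logLikelihood hq μ d)
    (measurable_pi_lambda _ fun i => by fun_prop)]
  congr 1
  funext ω
  exact Fin.sum_univ_eq_sum_range
    (fun i => Real.log (q (m + ω i - μ) / q (m + ω i + μ))) d

theorem map_logLikelihood_condDataLaw (hq : Measurable q) (μ : ℝ) (d : ℕ) (y : ℤˣ) :
    (condDataLaw q μ d y).map (fun p => logLikelihood q μ p.2) =
      (featureLaw q (((y : ℤ) : ℝ) * μ) d).map (logLikelihood q μ) := by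
  rw [← map_snd_condDataLaw, Measure.map_map (measurable_logLikelihood hq μ d) measurable_snd]
  rfl

/-- With features `μ + z i` the summands are `log q (z i) - log q (z i + 2μ)`, the increments with
`a = 2c`. -/
theorem tendstoInDistribution_logLikelihood_featureLaw (h1 : FisherRegular q)
    (h2 : LogThirdDerivBound q) (c : ℝ) :
    TendstoInDistribution
      (fun (d : ℕ) (x : Fin d → ℝ) => logLikelihood q (c / √(d : ℝ)) x) atTop (fun w : ℝ => w)
      (fun d : ℕ => featureLaw q (c / √(d : ℝ)) d)
      (gaussianReal (2 * c ^ 2 * fisherInfo q) (4 * c ^ 2 * fisherInfo q).toNNReal) := by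
  have hq : Measurable q := h1.differentiable.continuous.measurable
  refine (tendstoInDistribution_sum_log_sub h1 h2 (2 * c)).of_map_eq
    (fun d => (measurable_logLikelihood hq _ d).aemeasurable) aemeasurable_id' (fun d => ?_) ?_
  · rw [map_logLikelihood_featureLaw hq]
    congr 1
    funext ω
    refine Finset.sum_congr rfl fun i _ => ?_
    rw [Real.log_div (h1.pos _).ne' (h1.pos _).ne']
    congr 3 <;> ring
  · congr 2 <;> ring_nf

/-- With features `-μ + z i` the summands are `log q (z i - 2μ) - log q (z i)`, the negated
increments with `a = -2c`; the mean changes sign and the variance does not. -/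
theorem tendstoInDistribution_logLikelihood_featureLaw_neg (h1 : FisherRegular q)
    (h2 : LogThirdDerivBound q) (c : ℝ) :
    TendstoInDistribution
      (fun (d : ℕ) (x : Fin d → ℝ) => logLikelihood q (c / √(d : ℝ)) x) atTop (fun w : ℝ => w)
      (fun d : ℕ => featureLaw q (-(c / √(d : ℝ))) d)
      (gaussianReal (-(2 * c ^ 2 * fisherInfo q)) (4 * c ^ 2 * fisherInfo q).toNNReal) := by
  have hq : Measurable q := h1.differentiable.continuous.measurable
  have hneg := (tendstoInDistribution_sum_log_sub h1 h2 (-(2 * c))).continuous_comp continuous_neg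
  refine hneg.of_map_eq
    (fun d => (measurable_logLikelihood hq _ d).aemeasurable) aemeasurable_id' (fun d => ?_) ?_
  · rw [map_logLikelihood_featureLaw hq]
    congr 1
    funext ω
    simp only [Function.comp_apply]
    rw [← Finset.sum_neg_distrib]
    refine Finset.sum_congr rfl fun i _ => ?_
    rw [Real.log_div (h1.pos _).ne' (h1.pos _).ne', neg_sub]
    congr 3 <;> ring
  · refine (gaussianReal_map_neg.trans ?_).trans Measure.map_id.symm
    congr 2 <;> ring

theorem tendsto_optimalBayesError (h1 : FisherRegular q) (h2 : LogThirdDerivBound q) {c : ℝ}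
    (hc : 0 < c) :
    Tendsto (fun d : ℕ => optimalBayesError q (c / √(d : ℝ)) d) atTop
      (𝓝 (PhiBar (c * √(fisherInfo q)))) := by
  have hq : Measurable q := h1.differentiable.continuous.measurable
  have hI := h1.fisherInfo_pos
  -- The common standard deviation of the two limits.
  set s : ℝ := 2 * c * √(fisherInfo q) with hs_def
  have hs : 0 < s := by positivity
  have hs2 : 4 * c ^ 2 * fisherInfo q = s ^ 2 := by
    rw [hs_def, mul_pow, Real.sq_sqrt hI.le]
    ring
  have hratio : 2 * c ^ 2 * fisherInfo q / s = c * √(fisherInfo q) := by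
    rw [div_eq_iff hs.ne', hs_def]
    linear_combination (-2 * c ^ 2) * Real.mul_self_sqrt hI.le
  have hv : (s ^ 2).toNNReal ≠ 0 := by simpa using hs.ne'
  have hid (ρ : Measure ℝ) : ρ.map (fun w => w) = ρ := Measure.map_id
  have hpos := tendstoInDistribution_logLikelihood_featureLaw h1 h2 c
  have hneg := tendstoInDistribution_logLikelihood_featureLaw_neg h1 h2 c
  rw [hs2] at hpos hneg
  -- The threshold `0` is the frontier of both error regions, so it must be null for the limit laws.
  have hatom (m : ℝ) : gaussianReal m (s ^ 2).toNNReal {0} = 0 := by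
    have := nullSingletonClass_gaussianReal (μ := m) hv
    exact measure_singleton 0
  have hlim₁ := hpos.tendsto_real_preimage (s := Set.Iic 0) (by rw [hid, frontier_Iic, hatom])
  have hlim₂ := hneg.tendsto_real_preimage (s := Set.Ioi 0) (by rw [hid, frontier_Ioi, hatom])
  rw [hid, gaussianReal_real_Iic_zero _ hs, hratio] at hlim₁
  rw [hid, gaussianReal_neg_real_Ioi_zero _ hs, hratio] at hlim₂
  have hlim := (hlim₁.add hlim₂).const_mul 2⁻¹
  rw [← two_mul, inv_mul_cancel_left₀ two_ne_zero] at hlim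
  refine hlim.congr fun d => ?_
  rw [optimalBayesError_eq h1.pos hq,
    map_measureReal_apply (measurable_logLikelihood hq _ d) measurableSet_Iic,
    map_measureReal_apply (measurable_logLikelihood hq _ d) measurableSet_Ioi]
  rfl

end Asymptotics

end L0Classification

theorem theorem2 (q : ℝ → ℝ) [IsProbabilityMeasure (noise q)]
    (hint : Integrable (fun z : ℝ => z) (noise q))
    (hmean : ∫ z, z ∂(noise q) = 0)
    (h1 : FisherRegular q)
    (h2 : LogThirdDerivBound q)
    (c : ℝ) (hc : 0 < c) :
    (∀ θ : ℝ, fisherInfoAt q θ = fisherInfo q) ∧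
    Tendsto (fun d : ℕ => optimalBayesError q (c / √(d : ℝ)) d) atTop
      (𝓝 (PhiBar (c * √(fisherInfo q)))) ∧
    TendstoInDistribution
      (fun (d : ℕ) (p : ℤˣ × (Fin d → ℝ)) =>
        logLikelihood q (c / √(d : ℝ)) p.2)
      atTop (fun w : ℝ => w)
      (fun d : ℕ => condDataLaw q (c / √(d : ℝ)) d 1)
      (gaussianReal (2 * c ^ 2 * fisherInfo q)
        (Real.toNNReal (4 * c ^ 2 * fisherInfo q))) ∧
    TendstoInDistribution
      (fun (d : ℕ) (p : ℤˣ × (Fin d → ℝ)) =>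
        logLikelihood q (c / √(d : ℝ)) p.2)
      atTop (fun w : ℝ => w)
      (fun d : ℕ => condDataLaw q (c / √(d : ℝ)) d (-1))
      (gaussianReal (-(2 * c ^ 2 * fisherInfo q))
        (Real.toNNReal (4 * c ^ 2 * fisherInfo q))) := by
  have hq : Measurable q := h1.differentiable.continuous.measurable
  refine ⟨fisherInfoAt_eq_fisherInfo h1.pos h1.differentiable,
    tendsto_optimalBayesError h1 h2 hc, ?_, ?_⟩
  -- Given the label, the features have law `featureLaw`, so the ratio has the same law on both
  -- spaces and the convergence carries over.
  · refine (tendstoInDistribution_logLikelihood_featureLaw h1 h2 c).of_map_eq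
      (fun d => ((measurable_logLikelihood hq _ d).comp measurable_snd).aemeasurable)
      aemeasurable_id' (fun d => ?_) rfl
    rw [map_logLikelihood_condDataLaw hq]
    simp
  · refine (tendstoInDistribution_logLikelihood_featureLaw_neg h1 h2 c).of_map_eq
      (fun d => ((measurable_logLikelihood hq _ d).comp measurable_snd).aemeasurable)
      aemeasurable_id' (fun d => ?_) rfl
    rw [map_logLikelihood_condDataLaw hq]
    simp
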